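/- A composition $\alpha=(\alpha_1,\dots,\alpha_\ell)$ of $n\ge 0$ (written $\alpha\vDash n$) is a finite sequence of positive integers with sum $n$; its diagram has $\alpha_i$ left-justified cells in the $i$-th row from the bottom. A semi-standard Young row-strict composition tableau (SSYRT) of shape $\alpha$ is a filling $T$ of the diagram with positive integers, $T(i,k)$ being the entry in row $i$ (from the bottom) and column $k$ (from the left), such that (1) each row is strictly increasing from left to right; (2) the leftmost column is weakly increasing from bottom to top; (3) for all $1\le i<j\le\ell$ and $1\le k<\max_r\alpha_r$, if $T(j,k)<T(i,k+1)$ then $T(j,k+1)\le T(i,k+1)$, where the entry of a cell outside the diagram is $\infty$. It is standard if each of $1,\dots,n$ appears exactly once. Let $\mathcal R_\alpha=\sum_T x^T\in\mathbb Q[[x_1,x_2,\dots]]$, summed over all SSYRT $T$ of shape $\alpha$, where $x^T=\prod_i x_i^{v_i}$ and $v_i$ is the number of times $i$ appears in $T$. For $\beta\vDash n$ let $F_\beta=\sum_\gamma M_\gamma$ be Gessel's fundamental quasisymmetric function, where $\gamma$ runs over the refinements of $\beta$ and $M_\gamma=\sum_{i_1<\cdots<i_k}x_{i_1}^{\gamma_1}\cdots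 x_{i_k}^{\gamma_k}$. For a standard $T$ of shape $\alpha\vDash n$, the reverse descent set $\hat D(T)\subseteq\{1,\dots,n-1\}$ is the set of all $i$ such that $i+1$ lies in a column strictly to the right of the column of $i$. For $S=\{s_1<\dots<s_k\}\subseteq\{1,\dots,n-1\}$ let $\mathrm{comp}(S)=(s_1,s_2-s_1,\dots,n-s_k)$ (the empty composition if $n=0$). Proposition. Let $\alpha\vDash n$. Then $$\mathcal R_\alpha=\sum_{\beta\vDash n}d_{\alpha\beta}F_\beta,$$ where $d_{\alpha\beta}$ is the number of standard Young row-strict composition tableaux $T$ of shape $\alpha$ with $\mathrm{comp}(\hat D(T))=\beta$. Moreover, this is the only way to write $\mathcal R_\alpha$ as a rational linear combination of the $F_\beta$, $\beta\vDash n$, so that all coefficients of $\mathcal R_\alpha$ in Gessel's fundamental basis are nonnegative integers. Furthermore, $\mathcal R_\alpha$ is quasisymmetric: it is a formal power series of bounded degree in which, for every composition $(\gamma_1,\dots,\gamma_k)$ and all $i_1<\dots<i_k$, the coefficient of $x_{i_1}^{\gamma_1}\cdots x_{i_k}^{\gamma_k}$ equals that of $x_1^{\gamma_1}\cdots x_k^{\gamma_k}$.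 -/

import Mathlib

/-- The cells of the diagram of `α` in the French convention: `⟨i, k⟩` is the cell in row `i`
(numbered from the bottom) and column `k` (numbered from the left), both numbered from `0`. -/
abbrev Composition.Cell {n : ℕ} (α : Composition n) : Type :=
  Σ i : Fin α.length, Fin (α.blocksFun i)

/-- A filling of the diagram of `α` with positive integers. -/
abbrev Composition.Filling {n : ℕ} (α : Composition n) : Type := α.Cell → ℕ+

namespace YoungRowStrict

/-- The entry in row `i` and column `k`, where the entry of a cell outside the diagram is `∞`. -/
def entry {n : ℕ} {α : Composition n} (T : α.Filling) (i : Fin α.length) (k : ℕ) : ℕ∞ :=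
  if h : k < α.blocksFun i then ((T ⟨i, ⟨k, h⟩⟩ : ℕ) : ℕ∞) else ⊤

/-- Semi-standard Young row-strict composition tableaux of shape `α`. (Columns `k` beyond the
longest row have only entries `∞`, so the triple condition is automatic there.) -/
structure IsSSYRT {n : ℕ} {α : Composition n} (T : α.Filling) : Prop where
  row_strict : ∀ i : Fin α.length, StrictMono fun k : Fin (α.blocksFun i) => T ⟨i, k⟩
  col_weak : ∀ i j : Fin α.length, i < j → entry T i 0 ≤ entry T j 0
  triple : ∀ i j : Fin α.length, i < j → ∀ k : ℕ,
    entry T j k < entry T i (k + 1) → entry T j (k + 1) ≤ entry T i (k + 1)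

/-- Standard tableaux: each of `1, …, n` appears exactly once. -/
structure IsSYRT {n : ℕ} {α : Composition n} (T : α.Filling) : Prop extends IsSSYRT T where
  standard : Set.BijOn (fun c : α.Cell => (T c : ℕ)) Set.univ (Set.Icc 1 n)

/-- The exponent vector of the weight `x^T`: the label `v` appears `weight T v` times in `T`. -/
noncomputable def weight {n : ℕ} {α : Composition n} (T : α.Filling) : ℕ+ →₀ ℕ :=
  ∑ c : α.Cell, Finsupp.single (T c) 1

/-- The formal power series `∑ t, x ^ (w t)` in the variables `x₁, x₂, …`, for a family of
monomials in which every monomial occurs finitely often: the coefficient of a monomial is the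
number of its occurrences. -/
noncomputable def monomialSum {ι : Type} (w : ι → ℕ+ →₀ ℕ) : MvPowerSeries ℕ+ ℚ :=
  fun m => (Nat.card {t : ι // w t = m} : ℚ)

/-- The Young row-strict quasisymmetric Schur function: the sum of `x^T` over all SSYRT `T` of
shape `α`. -/
noncomputable def R {n : ℕ} (α : Composition n) : MvPowerSeries ℕ+ ℚ :=
  monomialSum fun T : {T : α.Filling // IsSSYRT T} => weight T.1

/-- The exponent vector of `x_{s 1} ^ γ_1 ⋯ x_{s k} ^ γ_k`. -/
noncomputable def exponent {n : ℕ} (γ : Composition n) (s : Fin γ.length → ℕ+) : ℕ+ →₀ ℕ :=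
  ∑ j, Finsupp.single (s j) (γ.blocksFun j)

/-- The monomial quasisymmetric function: the sum of `x_{i_1} ^ γ_1 ⋯ x_{i_k} ^ γ_k` over all
`i_1 < ⋯ < i_k`. -/
noncomputable def M {n : ℕ} (γ : Composition n) : MvPowerSeries ℕ+ ℚ :=
  monomialSum fun s : {s : Fin γ.length → ℕ+ // StrictMono s} => exponent γ s.1

/-- `γ` is a refinement of `β`: `β` is obtained from `γ` by summing collections of consecutive
parts. -/
def Refines {n : ℕ} (γ β : Composition n) : Prop :=
  ∃ c : Composition γ.length, γ.gather c = β

open Classical in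
/-- Gessel's fundamental quasisymmetric function: the sum of `M γ` over all refinements `γ`
of `β`. -/
noncomputable def F {n : ℕ} (β : Composition n) : MvPowerSeries ℕ+ ℚ :=
  ∑ γ : Composition n with Refines γ β, M γ

/-- A quasisymmetric function: a power series of bounded degree in which, for every composition
`γ` with `k` parts and all `i_1 < ⋯ < i_k`, the coefficient of `x_{i_1} ^ γ_1 ⋯ x_{i_k} ^ γ_k`
equals that of `x_1 ^ γ_1 ⋯ x_k ^ γ_k`. -/
structure IsQuasisymmetric (f : MvPowerSeries ℕ+ ℚ) : Prop where
  bounded_degree : ∃ N : ℕ, ∀ m : ℕ+ →₀ ℕ, MvPowerSeries.coeff m f ≠ 0 → m.degree ≤ N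
  coeff_eq : ∀ (n : ℕ) (γ : Composition n) (s : Fin γ.length → ℕ+), StrictMono s →
    MvPowerSeries.coeff (exponent γ s) f =
      MvPowerSeries.coeff (exponent γ fun j => Nat.succPNat j) f

open Classical in
/-- The reverse descent set: all `i` in `[n - 1]` such that `i + 1` appears in a column strictly
to the right of the column of `i`. -/
noncomputable def revDescentSet {n : ℕ} {α : Composition n} (T : α.Filling) : Finset ℕ :=
  {i ∈ Finset.Icc 1 (n - 1) | ∃ c d : α.Cell,
    (T c : ℕ) = i ∧ (T d : ℕ) = i + 1 ∧ (c.2 : ℕ) < (d.2 : ℕ)}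

/-- The composition `(s_1, s_2 - s_1, …, n - s_k)` of `n` that corresponds to the subset
`{s_1 < ⋯ < s_k}` of `[n - 1]`. (Mathlib's `compositionAsSetEquiv` uses `Fin (n - 1)`, where `i`
stands for the element `i + 1` of `[n - 1]`.) -/
def comp (n : ℕ) (S : Finset ℕ) : Composition n :=
  (compositionEquiv n).symm ((compositionAsSetEquiv n).symm {i : Fin (n - 1) | (i : ℕ) + 1 ∈ S})

/-- The number of standard Young row-strict composition tableaux of shape `α` whose reverse
descent set has composition `β`. -/
noncomputable def d {n : ℕ} (α β : Composition n) : ℕ :=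
  Nat.card {T : α.Filling // IsSYRT T ∧ comp n (revDescentSet T) = β}

/-- The sets that are counted in `R`, `M` and `d` are finite. -/
theorem finite_weight_eq {n : ℕ} {α : Composition n} (m : ℕ+ →₀ ℕ) :
    {T : α.Filling | weight T = m}.Finite := by
  refine (Set.Finite.pi' fun _ : α.Cell => m.support.finite_toSet).subset ?_
  rintro T rfl c
  simp only [weight, Finset.mem_coe, Finsupp.mem_support_iff, Finsupp.finsetSum_apply]
  intro h
  have := (Finset.sum_eq_zero_iff.1 h) c (Finset.mem_univ c)
  simp at this

theorem finite_exponent_eq {n : ℕ} (γ : Composition n) (m : ℕ+ →₀ ℕ) :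
    {s : Fin γ.length → ℕ+ | exponent γ s = m}.Finite := by
  refine (Set.Finite.pi' fun _ : Fin γ.length => m.support.finite_toSet).subset ?_
  rintro s rfl j
  simp only [exponent, Finset.mem_coe, Finsupp.mem_support_iff, Finsupp.finsetSum_apply]
  intro h
  have := (Finset.sum_eq_zero_iff.1 h) j (Finset.mem_univ j)
  have h2 := γ.one_le_blocksFun j
  simp at this
  omega

theorem finite_isSYRT {n : ℕ} (α : Composition n) : {T : α.Filling | IsSYRT T}.Finite := by
  refine (Set.Finite.pi' fun _ : α.Cell =>
    (Set.finite_Icc 1 n).preimage PNat.coe_injective.injOn).subset ?_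
  intro T hT c
  exact hT.standard.mapsTo (Set.mem_univ c)

end YoungRowStrict

/-! A monomial of degree `n` is the content of exactly one weakly increasing word `w`, and every
coefficient involved depends only on the ascent set of `w`. For `F β` it is 1 or 0 according to
whether `partialSums β ⊆ ascents w` (`coeff_F_content`). For `R α`, standardization writes each
tableau of content `w` uniquely as `w ∘ e`, where `e` numbers the cells as a standard tableau whose
reverse descents are all ascents of `w`. Hence the coefficient counts standard tableaux with reverse
descent set inside `ascents w` (`card_isSSYRT_weight_eq`); grouping them by descent composition
gives the expansion. Every subset of `[n - 1]` is an ascent set, so the coefficients in the `F β`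
are determined by triangularity under inclusion (`eq_of_forall_sum_ite_eq`). Quasisymmetry holds
because a strictly increasing change of variables preserves ascents. -/

namespace YoungRowStrict

open Finset

/-! ### Compositions as subsets, and refinement as inclusion -/

/-- The proper partial sums of a composition, as a subset of `[n - 1]`. -/
noncomputable def partialSums {n : ℕ} (γ : Composition n) : Finset ℕ := by
  classical exact {k ∈ Icc 1 (n - 1) | ∃ i, γ.sizeUpTo i = k}

theorem mem_partialSums {n : ℕ} {γ : Composition n} {k : ℕ} :
    k ∈ partialSums γ ↔ 0 < k ∧ k < n ∧ ∃ i, γ.sizeUpTo i = k := by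
  simp only [partialSums, mem_filter, mem_Icc]
  constructor
  · rintro ⟨h, i, hi⟩
    exact ⟨by omega, by omega, i, hi⟩
  · rintro ⟨h0, hn, i, hi⟩
    exact ⟨by omega, i, hi⟩

/-- The intersection is needed because `comp` ignores elements outside `[n - 1]`. The shift between
`Fin (n - 1)` and `[n - 1]` is confined to this proof. -/
theorem partialSums_eq_iff {n : ℕ} (γ : Composition n) (S : Finset ℕ) :
    S ∩ Icc 1 (n - 1) = partialSums γ ↔ comp n S = γ := by
  rw [comp, Equiv.symm_apply_eq, Equiv.symm_apply_eq]
  have key : ∀ i : Fin (n - 1), i ∈ compositionAsSetEquiv n (compositionEquiv n γ) ↔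
      (i : ℕ) + 1 ∈ partialSums γ := by
    intro i
    have hi := i.2
    simp only [compositionAsSetEquiv, compositionEquiv, Equiv.coe_fn_mk, Set.mem_toFinset,
      Set.mem_ofPred_eq, mem_partialSums, Composition.toCompositionAsSet, Composition.boundaries,
      mem_map, mem_univ, true_and, RelEmbedding.coe_toEmbedding, Composition.boundary,
      OrderEmbedding.coe_ofStrictMono, Fin.mk.injEq]
    constructor
    · rintro ⟨j, hj⟩
      exact ⟨by omega, by omega, j, by omega⟩
    · rintro ⟨-, -, j, hj⟩
      -- Boundaries are indexed up to `γ.length`; beyond it `sizeUpTo` stays equal to `n`.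
      refine ⟨⟨min j γ.length, by omega⟩, ?_⟩
      rcases le_total j γ.length with h | h
      · simp only [min_eq_left h]; omega
      · rw [γ.sizeUpTo_ofLength_le _ h] at hj
        simp only [min_eq_right h, γ.sizeUpTo_length]; omega
  constructor
  · intro h
    ext i
    have hi := i.2
    rw [key, ← h]
    simp only [mem_filter, mem_univ, true_and, mem_inter, mem_Icc]
    exact ⟨fun h => ⟨h, by omega⟩, fun h => h.1⟩
  · intro h
    ext k
    rcases k with _ | k
    · simp [mem_partialSums]
    · by_cases hk : k < n - 1
      · have := key ⟨k, hk⟩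
        rw [← h] at this
        simp only [mem_filter, mem_univ, true_and] at this
        rw [← this]
        simp only [mem_inter, mem_Icc]
        exact ⟨fun h => h.1, fun h => ⟨h, by omega⟩⟩
      · simp only [mem_inter, mem_Icc, mem_partialSums]
        omega

theorem partialSums_comp (n : ℕ) (S : Finset ℕ) :
    partialSums (comp n S) = S ∩ Icc 1 (n - 1) :=
  ((partialSums_eq_iff _ S).2 rfl).symm

theorem partialSums_subset_Icc {n : ℕ} (γ : Composition n) : partialSums γ ⊆ Icc 1 (n - 1) := by
  classical exact filter_subset _ _

theorem partialSums_injective (n : ℕ) :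
    Function.Injective (partialSums : Composition n → Finset ℕ) := by
  intro γ γ' h
  have h1 := (partialSums_eq_iff γ (partialSums γ)).1 (inter_eq_left.2 (partialSums_subset_Icc γ))
  have h2 := (partialSums_eq_iff γ' (partialSums γ)).1
    ((inter_eq_left.2 (partialSums_subset_Icc γ)).trans h)
  exact h1.symm.trans h2

theorem sizeUpTo_gather {n : ℕ} (γ : Composition n) (c : Composition γ.length) {i : ℕ}
    (hi : i < c.length) : (γ.gather c).sizeUpTo i = γ.sizeUpTo (c.sizeUpTo i) := by
  have := γ.sizeUpTo_sizeUpTo_add c (j := 0) hi (c.one_le_blocksFun _)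
  simpa using this.symm

theorem mem_partialSums_gather {n : ℕ} {γ : Composition n} {c : Composition γ.length} {k : ℕ} :
    k ∈ partialSums (γ.gather c) ↔ ∃ j ∈ partialSums c, γ.sizeUpTo j = k := by
  have hl : (γ.gather c).length = c.length := γ.length_gather c
  rw [mem_partialSums]
  constructor
  · rintro ⟨h0, hn, i, rfl⟩
    have hi : i < c.length := by
      by_contra h
      rw [(γ.gather c).sizeUpTo_ofLength_le i (by omega)] at hn
      omega
    rw [sizeUpTo_gather γ c hi] at h0 hn
    refine ⟨c.sizeUpTo i, mem_partialSums.2 ⟨Nat.pos_of_ne_zero fun h => ?_, ?_, i, rfl⟩,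
      (sizeUpTo_gather γ c hi).symm⟩
    · simp [h] at h0
    · by_contra h
      rw [γ.sizeUpTo_ofLength_le _ (by omega)] at hn
      omega
  · rintro ⟨j, hj, rfl⟩
    obtain ⟨h0, hn, i, rfl⟩ := mem_partialSums.1 hj
    have hi : i < c.length := by
      by_contra h
      rw [c.sizeUpTo_ofLength_le i (by omega)] at hn
      omega
    refine ⟨?_, ?_, i, sizeUpTo_gather γ c hi⟩
    · have := γ.sizeUpTo_strict_mono (i := 0) (by omega)
      exact (Nat.zero_le _).trans_lt (this.trans_le (γ.monotone_sizeUpTo h0))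
    · have := (γ.sizeUpTo_strict_mono hn).trans_le (γ.sizeUpTo_le _)
      exact this

theorem refines_iff {n : ℕ} {γ β : Composition n} :
    Refines γ β ↔ partialSums β ⊆ partialSums γ := by
  classical
  constructor
  · rintro ⟨c, rfl⟩ k hk
    obtain ⟨j, -, hj⟩ := mem_partialSums_gather.1 hk
    obtain ⟨h0, hn, -⟩ := mem_partialSums.1 hk
    exact mem_partialSums.2 ⟨h0, hn, j, hj⟩
  · intro h
    -- The blocks of `γ` are grouped by cutting after those whose partial sum is also one of `β`.
    refine ⟨comp γ.length {j ∈ Icc 1 (γ.length - 1) | γ.sizeUpTo j ∈ partialSums β},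
      partialSums_injective n ?_⟩
    ext k
    rw [mem_partialSums_gather]
    simp only [partialSums_comp, mem_inter, mem_filter, mem_Icc]
    constructor
    · rintro ⟨j, ⟨⟨-, hj⟩, -⟩, rfl⟩
      exact hj
    · intro hk
      obtain ⟨h0, hn, j, rfl⟩ := mem_partialSums.1 (h hk)
      have h1 : 0 < j := Nat.pos_of_ne_zero fun h => by simp [h] at h0
      have h2 : j < γ.length := by
        by_contra h
        rw [γ.sizeUpTo_ofLength_le j (by omega)] at hn
        omega
      exact ⟨j, ⟨⟨by omega, hk⟩, by omega⟩, rfl⟩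

/-! ### Weakly increasing words, their contents and ascents -/

/-- The content of a word. -/
noncomputable def content {n : ℕ} (w : Fin n → ℕ+) : ℕ+ →₀ ℕ :=
  ∑ p, Finsupp.single (w p) 1

/-- The positions `k` such that the `k`-th letter of `w` is less than the next one. -/
noncomputable def ascents {X : Type*} [LT X] {n : ℕ} (w : Fin n → X) : Finset ℕ := by
  classical exact {k ∈ Icc 1 (n - 1) | ∃ p q : Fin n, (p : ℕ) + 1 = k ∧ (q : ℕ) = k ∧ w p < w q}

theorem mem_ascents {X : Type*} [LT X] {n : ℕ} {w : Fin n → X} {k : ℕ} :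
    k ∈ ascents w ↔ ∃ p q : Fin n, (p : ℕ) + 1 = k ∧ (q : ℕ) = k ∧ w p < w q := by
  simp only [ascents, mem_filter, mem_Icc, and_iff_right_iff_imp]
  rintro ⟨p, q, h1, h2, -⟩
  omega

theorem ascents_subset_Icc {X : Type*} [LT X] {n : ℕ} (w : Fin n → X) :
    ascents w ⊆ Icc 1 (n - 1) := by
  classical exact filter_subset _ _

theorem lt_iff_exists_mem_ascents {X : Type*} [LinearOrder X] {n : ℕ} {w : Fin n → X}
    (hw : Monotone w) {p q : Fin n} :
    w p < w q ↔ ∃ k ∈ ascents w, (p : ℕ) < k ∧ k ≤ q := by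
  constructor
  · intro h
    have hpq : p < q := hw.reflect_lt h
    by_contra! hcon
    -- With no ascent between `p` and `q`, the word is constant there.
    have : ∀ r : ℕ, ∀ hr : r < n, (p : ℕ) ≤ r → r ≤ q → w ⟨r, hr⟩ = w p := by
      intro r
      induction r with
      | zero => intro hr h1 _; congr 1; ext; simp at h1 ⊢; omega
      | succ r ih =>
        intro hr h1 h2
        rcases Nat.lt_or_ge r p with h3 | h3
        · congr 1; ext; simp; omega
        · have h4 := ih (by omega) h3 (by omega)
          refine le_antisymm ?_ (hw h1)
          by_contra! h5
          have := hcon (r + 1) (mem_ascents.2 ⟨⟨r, by omega⟩, ⟨r + 1, hr⟩, rfl, rfl, h4 ▸ h5⟩)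
            (by omega)
          omega
    exact absurd (this q q.2 hpq.le le_rfl) h.ne'
  · rintro ⟨k, hk, h1, h2⟩
    obtain ⟨a, b, ha, hb, hab⟩ := mem_ascents.1 hk
    exact (hw (show p ≤ a by rw [Fin.le_def]; omega)).trans_lt
      (hab.trans_le (hw (show b ≤ q by rw [Fin.le_def]; omega)))

theorem sizeUpTo_le_iff {n : ℕ} (γ : Composition n) (p : Fin n) (i : ℕ) :
    γ.sizeUpTo i ≤ p ↔ i ≤ γ.index p := by
  constructor
  · intro h
    by_contra! h'
    exact absurd ((γ.monotone_sizeUpTo (Nat.succ_le_of_lt h')).trans h)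
      (γ.lt_sizeUpTo_index_succ p).not_ge
  · intro h
    exact (γ.monotone_sizeUpTo h).trans (γ.sizeUpTo_index_le p)

theorem monotone_index {n : ℕ} (γ : Composition n) : Monotone γ.index := fun p q h => by
  rw [Fin.le_def, ← sizeUpTo_le_iff]
  exact (γ.sizeUpTo_index_le p).trans h

theorem index_surjective {n : ℕ} (γ : Composition n) : Function.Surjective γ.index := fun i =>
  ⟨γ.embedding i ⟨0, γ.one_le_blocksFun i⟩, γ.index_embedding _ _⟩

theorem ascents_index {n : ℕ} (γ : Composition n) : ascents γ.index = partialSums γ := by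
  ext k
  rw [mem_ascents, mem_partialSums]
  constructor
  · rintro ⟨p, q, hp, hq, h⟩
    refine ⟨by omega, by omega, γ.index q, ?_⟩
    have h1 := γ.sizeUpTo_index_le q
    have h2 := mt (sizeUpTo_le_iff γ p (γ.index q)).1 (by rw [Fin.lt_def] at h; omega)
    omega
  · rintro ⟨h0, hn, i, hi⟩
    refine ⟨⟨k - 1, by omega⟩, ⟨k, hn⟩, by simp; omega, rfl, ?_⟩
    have h1 := (sizeUpTo_le_iff γ ⟨k, hn⟩ i).1 hi.le
    have h2 := mt (sizeUpTo_le_iff γ ⟨k - 1, by omega⟩ i).2 (by simp; omega)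
    rw [Fin.lt_def]
    omega

/-- The word `s ∘ γ.index` repeats the letter `s j` along the whole `j`-th block. -/
theorem exponent_eq_content {n : ℕ} (γ : Composition n) (s : Fin γ.length → ℕ+) :
    exponent γ s = content (s ∘ γ.index) := by
  rw [content, ← γ.blocksFinEquiv.sum_comp, Fintype.sum_sigma, exponent]
  refine sum_congr rfl fun i _ => ?_
  have : ∀ x : Fin (γ.blocksFun i), γ.index (γ.blocksFinEquiv ⟨i, x⟩) = i :=
    fun x => γ.index_embedding i x
  simp [this]

theorem degree_content {n : ℕ} (w : Fin n → ℕ+) : (content w).degree = n := by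
  simp [content, map_sum]

theorem toMultiset_content {n : ℕ} (w : Fin n → ℕ+) :
    (content w).toMultiset = (List.ofFn w : Multiset ℕ+) := by
  rw [← Fin.univ_val_map, content, map_sum]
  simp only [Finsupp.toMultiset_single, one_smul]
  have := Multiset.sum_map_singleton (univ.val.map w)
  rwa [Multiset.map_map] at this

/-- A weakly increasing word is the sorted list of the multiset of its letters. -/
theorem content_injOn {n : ℕ} : Set.InjOn (content : (Fin n → ℕ+) → _) {w | Monotone w} := by
  intro w hw w' hw' h
  have h2 : List.Perm (List.ofFn w) (List.ofFn w') := by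
    rw [← Multiset.coe_eq_coe, ← toMultiset_content, ← toMultiset_content, h]
  exact List.ofFn_injective (h2.eq_of_sortedLE (Monotone.sortedLE_ofFn hw)
    (Monotone.sortedLE_ofFn hw'))

theorem exists_monotone_content {n : ℕ} (m : ℕ+ →₀ ℕ) (hm : m.degree = n) :
    ∃ w : Fin n → ℕ+, Monotone w ∧ content w = m := by
  have hl : (m.toMultiset.sort).length = n := by
    rw [Multiset.length_sort, Finsupp.card_toMultiset, ← hm]
    rfl
  subst hl
  refine ⟨(m.toMultiset.sort).get, ?_, Multiset.toFinsupp.symm.injective ?_⟩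
  · rw [← List.sortedLE_ofFn_iff, List.ofFn_get]
    exact (Multiset.pairwise_sort _ _).sortedLE
  · change Finsupp.toMultiset _ = Finsupp.toMultiset m
    rw [toMultiset_content, List.ofFn_get, Multiset.sort_eq]

/-- Monotone words with the same ascents compare the same positions as equal. -/
theorem lt_iff_lt_of_ascents_eq {X Y : Type*} [LinearOrder X] [LinearOrder Y] {n : ℕ}
    {v : Fin n → X} {w : Fin n → Y} (hv : Monotone v) (hw : Monotone w)
    (h : ascents v = ascents w) (p q : Fin n) : v p < v q ↔ w p < w q := by
  rw [lt_iff_exists_mem_ascents hv, lt_iff_exists_mem_ascents hw, h]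

theorem ascents_strictMono_comp {X Y : Type*} [LinearOrder X] [LinearOrder Y] {n : ℕ}
    (v : Fin n → X) {s : X → Y} (hs : StrictMono s) : ascents (s ∘ v) = ascents v := by
  ext k
  simp [mem_ascents, hs.lt_iff_lt]

/-- Such a `w` is constant on the blocks of `γ` and jumps at each boundary, so `s` can be read off
at any position of each block. -/
theorem exists_strictMono_comp_index {n : ℕ} (γ : Composition n) {w : Fin n → ℕ+}
    (hw : Monotone w) (h : partialSums γ = ascents w) :
    ∃ s : Fin γ.length → ℕ+, StrictMono s ∧ s ∘ γ.index = w := by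
  rw [← ascents_index] at h
  have key := lt_iff_lt_of_ascents_eq (monotone_index γ) hw h
  have hg := Function.surjInv_eq (index_surjective γ)
  refine ⟨w ∘ Function.surjInv (index_surjective γ), fun a b hab => ?_, funext fun p => ?_⟩
  · exact (key _ _).1 (by rwa [hg, hg])
  · refine le_antisymm ?_ ?_ <;> rw [← not_lt] <;> simp [← key, hg]

/-! ### Coefficients of the monomial and fundamental functions -/

theorem card_fiber_of_injective {ι X : Type} {f : ι → X} (hf : Function.Injective f) (x : X)
    [Decidable (∃ t, f t = x)] : Nat.card {t // f t = x} = if ∃ t, f t = x then 1 else 0 := by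
  split_ifs with h
  · obtain ⟨t, rfl⟩ := h
    exact Nat.card_eq_one_iff_unique.2
      ⟨⟨fun a b => Subtype.ext (hf (a.2.trans b.2.symm))⟩, ⟨⟨t, rfl⟩⟩⟩
  · have : IsEmpty {t // f t = x} := ⟨fun t => h ⟨t, t.2⟩⟩
    simp

theorem exponent_injOn {n : ℕ} (γ : Composition n) :
    Set.InjOn (exponent γ) {s | StrictMono s} := by
  intro s hs s' hs' h
  rw [exponent_eq_content, exponent_eq_content] at h
  exact (index_surjective γ).injective_comp_right (content_injOn
    (hs.monotone.comp (monotone_index γ)) (hs'.monotone.comp (monotone_index γ)) h)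

theorem coeff_M_content {n : ℕ} (γ : Composition n) {w : Fin n → ℕ+} (hw : Monotone w) :
    MvPowerSeries.coeff (content w) (M γ) = if partialSums γ = ascents w then 1 else 0 := by
  classical
  have h1 : MvPowerSeries.coeff (content w) (M γ) = (Nat.card
      {t : {s : Fin γ.length → ℕ+ // StrictMono s} // exponent γ t.1 = content w} : ℚ) := rfl
  have hinj : Function.Injective
      fun t : {s : Fin γ.length → ℕ+ // StrictMono s} => exponent γ t.1 :=
    fun a b h => Subtype.ext (exponent_injOn γ a.2 b.2 h)
  rw [h1, card_fiber_of_injective hinj]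
  have h2 : (∃ t : {s : Fin γ.length → ℕ+ // StrictMono s}, exponent γ t.1 = content w) ↔
      partialSums γ = ascents w := by
    constructor
    · rintro ⟨⟨s, hs⟩, h⟩
      rw [exponent_eq_content] at h
      rw [← content_injOn (hs.monotone.comp (monotone_index γ)) hw h,
        ascents_strictMono_comp _ hs, ascents_index]
    · intro h
      obtain ⟨s, hs, rfl⟩ := exists_strictMono_comp_index γ hw h
      exact ⟨⟨s, hs⟩, exponent_eq_content γ s⟩
  simp only [h2]
  split_ifs <;> simp

theorem coeff_M_of_degree_ne {n : ℕ} (γ : Composition n) {m : ℕ+ →₀ ℕ} (hm : m.degree ≠ n) :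
    MvPowerSeries.coeff m (M γ) = 0 := by
  have : IsEmpty {t : {s : Fin γ.length → ℕ+ // StrictMono s} // exponent γ t.1 = m} :=
    ⟨fun t => hm (by rw [← t.2, exponent_eq_content, degree_content])⟩
  change (Nat.card
    {t : {s : Fin γ.length → ℕ+ // StrictMono s} // exponent γ t.1 = m} : ℚ) = 0
  simp

/-- Only one `M γ` contains this monomial, namely that with `partialSums γ = ascents w`; it occurs
in `F β` when this `γ` refines `β`. -/
theorem coeff_F_content {n : ℕ} (β : Composition n) {w : Fin n → ℕ+} (hw : Monotone w) :
    MvPowerSeries.coeff (content w) (F β) = if partialSums β ⊆ ascents w then 1 else 0 := by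
  classical
  have hγ : partialSums (comp n (ascents w)) = ascents w := by
    rw [partialSums_comp, inter_eq_left]
    exact ascents_subset_Icc w
  have h1 : ∀ γ : Composition n, partialSums γ = ascents w ↔ γ = comp n (ascents w) := fun γ =>
    ⟨fun h => partialSums_injective n (h.trans hγ.symm), fun h => h ▸ hγ⟩
  simp only [F, map_sum, coeff_M_content _ hw, h1, sum_ite_eq', mem_filter, mem_univ, true_and,
    refines_iff, hγ]

theorem coeff_F_of_degree_ne {n : ℕ} (β : Composition n) {m : ℕ+ →₀ ℕ} (hm : m.degree ≠ n) :
    MvPowerSeries.coeff m (F β) = 0 := by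
  simp [F, coeff_M_of_degree_ne _ hm]

theorem isQuasisymmetric_of_content {n : ℕ} {f : MvPowerSeries ℕ+ ℚ} (g : Finset ℕ → ℚ)
    (hf : ∀ m : ℕ+ →₀ ℕ, m.degree ≠ n → MvPowerSeries.coeff m f = 0)
    (hg : ∀ w : Fin n → ℕ+, Monotone w → MvPowerSeries.coeff (content w) f = g (ascents w)) :
    IsQuasisymmetric f where
  bounded_degree := ⟨n, fun m hm => (not_imp_comm.1 (hf m) hm).le⟩
  coeff_eq := by
    intro n' γ s hs
    have h0 : StrictMono fun j : Fin γ.length => Nat.succPNat j := fun i j hij =>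
      Nat.succPNat_lt_succPNat.2 hij
    rw [exponent_eq_content, exponent_eq_content]
    by_cases hn : n' = n
    · subst hn
      rw [hg _ (hs.monotone.comp (monotone_index γ)), hg _ (h0.monotone.comp (monotone_index γ)),
        ascents_strictMono_comp _ hs, ascents_strictMono_comp _ h0]
    · rw [hf _ (by rwa [degree_content]), hf _ (by rwa [degree_content])]

/-- Möbius-type triangularity: apart from `γ` itself, only compositions with fewer partial sums
contribute, and these agree by induction. -/
theorem eq_of_forall_sum_ite_eq {n : ℕ} {c d : Composition n → ℚ}
    (h : ∀ γ : Composition n, (∑ β, if partialSums β ⊆ partialSums γ then c β else 0) =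
      ∑ β, if partialSums β ⊆ partialSums γ then d β else 0) (γ : Composition n) :
    c γ = d γ := by
  classical
  induction hk : (partialSums γ).card using Nat.strong_induction_on generalizing γ with
  | _ k ih =>
    subst hk
    have h1 := h γ
    rw [← add_sum_erase _ _ (mem_univ γ), ← add_sum_erase (f := fun β =>
      if partialSums β ⊆ partialSums γ then d β else 0) _ (mem_univ γ), if_pos Subset.rfl,
      if_pos Subset.rfl] at h1
    refine add_right_cancel (h1.trans (congrArg _ (sum_congr rfl fun β hβ => ?_)))
    split_ifs with hs
    · refine (ih _ (card_lt_card (hs.ssubset_of_ne fun h => ?_)) β rfl).symm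
      exact (mem_erase.1 hβ).1 (partialSums_injective n h)
    · rfl

theorem exists_content_ascents_eq {n : ℕ} (γ : Composition n) :
    ∃ w : Fin n → ℕ+, Monotone w ∧ ascents w = partialSums γ := by
  have h0 : StrictMono fun j : Fin γ.length => Nat.succPNat j := fun i j hij =>
    Nat.succPNat_lt_succPNat.2 hij
  exact ⟨_, h0.monotone.comp (monotone_index γ), by rw [ascents_strictMono_comp _ h0, ascents_index]⟩

/-! ### Tableaux in terms of cells, and standard numberings -/

variable {n : ℕ} {α : Composition n}

/-- The conditions on the entries of a semi-standard tableau, for entries in any ordered type and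
in terms of the cells only. -/
structure IsTableau {X : Type*} [LinearOrder X] (T : α.Cell → X) : Prop where
  row : ∀ c d : α.Cell, c.1 = d.1 → (c.2 : ℕ) < d.2 → T c < T d
  col : ∀ c d : α.Cell, (c.2 : ℕ) = 0 → (d.2 : ℕ) = 0 → c.1 < d.1 → T c ≤ T d
  triple : ∀ c d : α.Cell, c.1 < d.1 → (c.2 : ℕ) = d.2 + 1 → T d < T c →
    ∃ d' : α.Cell, d'.1 = d.1 ∧ (d'.2 : ℕ) = c.2 ∧ T d' ≤ T c

theorem cell_ext {c d : α.Cell} (h1 : c.1 = d.1) (h2 : (c.2 : ℕ) = d.2) : c = d := by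
  obtain ⟨i, k⟩ := c
  obtain ⟨j, l⟩ := d
  obtain rfl : i = j := h1
  obtain rfl : k = l := Fin.ext h2
  rfl

theorem entry_of_lt (T : α.Filling) {i : Fin α.length} {k : ℕ} (h : k < α.blocksFun i) :
    entry T i k = ((T ⟨i, ⟨k, h⟩⟩ : ℕ) : ℕ∞) := dif_pos h

theorem entry_of_not_lt (T : α.Filling) {i : Fin α.length} {k : ℕ} (h : ¬ k < α.blocksFun i) :
    entry T i k = ⊤ := dif_neg h

theorem isSSYRT_iff_isTableau {T : α.Filling} : IsSSYRT T ↔ IsTableau T := by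
  constructor
  · intro hT
    refine ⟨?_, ?_, ?_⟩
    · rintro ⟨i, k⟩ ⟨j, l⟩ (rfl : i = j) hkl
      exact hT.row_strict i hkl
    · rintro ⟨i, k, hk⟩ ⟨j, l, hl⟩ (rfl : k = 0) (rfl : l = 0) hij
      have := hT.col_weak i j hij
      rw [entry_of_lt T hk, entry_of_lt T hl] at this
      exact_mod_cast this
    · rintro ⟨i, k, hk⟩ ⟨j, l, hl⟩ hij (rfl : k = l + 1) hlt
      have := hT.triple i j hij l
      rw [entry_of_lt T hk, entry_of_lt T hl] at this
      have h2 := this (by exact_mod_cast hlt)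
      by_cases h : l + 1 < α.blocksFun j
      · rw [entry_of_lt T h] at h2
        exact ⟨⟨j, ⟨l + 1, h⟩⟩, rfl, rfl, by exact_mod_cast h2⟩
      · rw [entry_of_not_lt T h] at h2
        exact absurd (top_le_iff.1 h2) (ENat.natCast_ne_top _)
  · intro hT
    refine ⟨?_, ?_, ?_⟩
    · intro i k l hkl
      exact hT.row ⟨i, k⟩ ⟨i, l⟩ rfl hkl
    · intro i j hij
      rw [entry_of_lt T (α.one_le_blocksFun i), entry_of_lt T (α.one_le_blocksFun j)]
      exact_mod_cast hT.col ⟨i, ⟨0, _⟩⟩ ⟨j, ⟨0, _⟩⟩ rfl rfl hij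
    · intro i j hij k
      by_cases h1 : k + 1 < α.blocksFun i
      · by_cases h2 : k < α.blocksFun j
        · rw [entry_of_lt T h1, entry_of_lt T h2]
          intro hlt
          obtain ⟨⟨j', k', hk'⟩, rfl : j' = j, rfl : k' = k + 1, hle⟩ :=
            hT.triple ⟨i, ⟨k + 1, h1⟩⟩ ⟨j, ⟨k, h2⟩⟩ hij rfl (by exact_mod_cast hlt)
          rw [entry_of_lt T hk']
          exact_mod_cast hle
        · rw [entry_of_not_lt T h2]
          exact fun h => absurd h not_top_lt
      · rw [entry_of_not_lt T h1]
        exact fun _ => le_top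

theorem isTableau_comp_iff {X Y : Type*} [LinearOrder X] [LinearOrder Y] {T : α.Cell → X}
    {f : X → Y} (hf : StrictMono f) : IsTableau (f ∘ T) ↔ IsTableau T :=
  ⟨fun h => ⟨by simpa [hf.lt_iff_lt] using h.row, by simpa [hf.le_iff_le] using h.col,
    by simpa [hf.le_iff_le, hf.lt_iff_lt] using h.triple⟩,
  fun h => ⟨by simpa [hf.lt_iff_lt] using h.row, by simpa [hf.le_iff_le] using h.col,
    by simpa [hf.le_iff_le, hf.lt_iff_lt] using h.triple⟩⟩

/-- The standard filling that belongs to a numbering of the cells. -/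
def standardFilling (e : α.Cell ≃ Fin n) : α.Filling := fun c => Nat.succPNat (e c)

theorem coe_standardFilling (e : α.Cell ≃ Fin n) (c : α.Cell) :
    (standardFilling e c : ℕ) = e c + 1 := rfl

theorem standardFilling_injective :
    Function.Injective (standardFilling : (α.Cell ≃ Fin n) → α.Filling) := fun e e' h => by
  ext c
  exact Nat.succPNat_injective (congrFun h c)

theorem isSYRT_iff {U : α.Filling} :
    IsSYRT U ↔ ∃ e : α.Cell ≃ Fin n, IsTableau e ∧ standardFilling e = U := by
  have hs : StrictMono fun p : Fin n => Nat.succPNat p := fun p q h =>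
    Nat.succPNat_lt_succPNat.2 h
  constructor
  · intro hU
    have hmem : ∀ c, (U c : ℕ) ∈ Set.Icc 1 n := fun c => hU.standard.mapsTo (Set.mem_univ c)
    have hb : Function.Bijective fun c => (⟨(U c : ℕ) - 1, by
        have := hmem c; simp only [Set.mem_Icc] at this; omega⟩ : Fin n) := by
      constructor
      · intro c d h
        refine hU.standard.injOn (Set.mem_univ c) (Set.mem_univ d) ?_
        have h1 := hmem c
        have h2 := hmem d
        simp only [Set.mem_Icc, Fin.mk.injEq] at *
        omega
      · intro p
        obtain ⟨c, -, hc⟩ := hU.standard.surjOn (show (p : ℕ) + 1 ∈ Set.Icc 1 n by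
          simp only [Set.mem_Icc]; omega)
        exact ⟨c, Fin.ext (by simp only at hc ⊢; omega)⟩
    have he : standardFilling (Equiv.ofBijective _ hb) = U := by
      funext c
      have h1 := hmem c
      refine PNat.eq ?_
      rw [coe_standardFilling]
      simp only [Set.mem_Icc] at h1
      simp only [Equiv.ofBijective_apply]
      omega
    refine ⟨Equiv.ofBijective _ hb, ?_, he⟩
    rw [← isTableau_comp_iff hs]
    have := isSSYRT_iff_isTableau.1 hU.toIsSSYRT
    rw [← he] at this
    exact this
  · rintro ⟨e, he, rfl⟩
    refine ⟨isSSYRT_iff_isTableau.2 ((isTableau_comp_iff hs).2 he), ?_, ?_, ?_⟩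
    · intro c _
      simp only [coe_standardFilling, Set.mem_Icc]
      omega
    · intro c _ d _ h
      simp only [coe_standardFilling] at h
      exact e.injective (Fin.ext (by omega))
    · intro k hk
      simp only [Set.mem_Icc] at hk
      refine ⟨e.symm ⟨k - 1, by omega⟩, Set.mem_univ _, ?_⟩
      simp only [coe_standardFilling, Equiv.apply_symm_apply]
      omega

/-- The word `w` ascends wherever the numbering `e` of the cells has a reverse descent. -/
def Compatible {X : Type*} [LT X] (e : α.Cell ≃ Fin n) (w : Fin n → X) : Prop :=
  ∀ c d : α.Cell, (e d : ℕ) = e c + 1 → (c.2 : ℕ) < d.2 → w (e c) < w (e d)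

theorem revDescentSet_subset_Icc (T : α.Filling) : revDescentSet T ⊆ Icc 1 (n - 1) := by
  classical exact filter_subset _ _

theorem revDescentSet_standardFilling_subset_iff (e : α.Cell ≃ Fin n) (w : Fin n → ℕ+) :
    revDescentSet (standardFilling e) ⊆ ascents w ↔ Compatible e w := by
  constructor
  · intro h c d hcd hlt
    have hmem : (e c : ℕ) + 1 ∈ revDescentSet (standardFilling e) := by
      simp only [revDescentSet, mem_filter, mem_Icc]
      exact ⟨by omega, c, d, rfl, by rw [coe_standardFilling, hcd], hlt⟩
    obtain ⟨p, q, hp, hq, hpq⟩ := mem_ascents.1 (h hmem)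
    obtain rfl : p = e c := Fin.ext (by omega)
    obtain rfl : q = e d := Fin.ext (by omega)
    exact hpq
  · intro h k hk
    rw [revDescentSet, mem_filter] at hk
    obtain ⟨-, c, d, hc, hd, hlt⟩ := hk
    rw [coe_standardFilling] at hc hd
    exact mem_ascents.2 ⟨e c, e d, hc, by omega, h c d (by omega) hlt⟩

/-! ### Standardization -/

variable {X : Type*}

/-- The order in which the cells are numbered in the standardization of `T`: by entries, equal
entries from right to left, and equal entries of one column upwards in the first column and
downwards in the others. -/
def key (T : α.Cell → X) (c : α.Cell) : X ×ₗ ℤ ×ₗ ℤ :=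
  toLex (T c, toLex (-(c.2 : ℤ), if (c.2 : ℕ) = 0 then (c.1 : ℤ) else -(c.1 : ℤ)))

theorem key_injective (T : α.Cell → X) : Function.Injective (key T) := by
  intro c d h
  simp only [key, EmbeddingLike.apply_eq_iff_eq, Prod.mk.injEq, neg_inj, Nat.cast_inj] at h
  obtain ⟨-, h1, h2⟩ := h
  rw [h1] at h2
  exact cell_ext (Fin.ext (by split_ifs at h2 <;> omega)) h1

variable [LinearOrder X]

theorem key_lt_key_iff {T : α.Cell → X} {c d : α.Cell} :
    key T c < key T d ↔ T c < T d ∨ T c = T d ∧ ((d.2 : ℕ) < c.2 ∨ (c.2 : ℕ) = d.2 ∧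
      (((c.2 : ℕ) = 0 ∧ c.1 < d.1) ∨ ((c.2 : ℕ) ≠ 0 ∧ d.1 < c.1))) := by
  simp only [key, Prod.Lex.toLex_lt_toLex]
  refine or_congr_right (and_congr_right fun _ => or_congr (by omega) ?_)
  rw [neg_inj, Nat.cast_inj]
  refine and_congr_right fun h => ?_
  rw [← h, Fin.lt_def, Fin.lt_def]
  split_ifs <;> omega

theorem exists_numbering {K : Type*} [LinearOrder K] {f : α.Cell → K}
    (hf : Function.Injective f) :
    ∃ e : α.Cell ≃ Fin n, ∀ c d, e c < e d ↔ f c < f d := by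
  classical
  have hc : (univ.image f).card = n := by
    rw [card_image_of_injective _ hf, card_univ, Fintype.card_congr α.blocksFinEquiv,
      Fintype.card_fin]
  have hmem : ∀ c, f c ∈ univ.image f := fun c => mem_image_of_mem f (mem_univ c)
  have hb : Function.Bijective fun c => ((univ.image f).orderIsoOfFin hc).symm ⟨f c, hmem c⟩ := by
    refine ⟨fun c d h => hf ?_, fun p => ?_⟩
    · exact congrArg Subtype.val (((univ.image f).orderIsoOfFin hc).symm.injective h)
    · obtain ⟨c, -, hc'⟩ := mem_image.1 ((univ.image f).orderIsoOfFin hc p).2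
      exact ⟨c, (OrderIso.symm_apply_eq _).2 (Subtype.ext hc')⟩
  exact ⟨Equiv.ofBijective _ hb, fun c d => by simp⟩

/-- Consecutive numbers carrying equal letters cannot move to the right, since a move to the right
forces an ascent. -/
theorem Compatible.column_le {e : α.Cell ≃ Fin n} {w : Fin n → X} (h : Compatible e w)
    (hw : Monotone w) {c d : α.Cell} (hcd : e c ≤ e d) (heq : w (e c) = w (e d)) :
    (d.2 : ℕ) ≤ c.2 := by
  obtain ⟨k, hk⟩ := Nat.exists_eq_add_of_le (Fin.le_def.1 hcd)
  induction k generalizing d with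
  | zero =>
    obtain rfl : d = c := e.injective (Fin.ext hk)
    rfl
  | succ k ih =>
    obtain ⟨b, hb⟩ := e.surjective ⟨e c + k, by omega⟩
    have hb' : (e b : ℕ) = e c + k := congrArg Fin.val hb
    have h1 : e c ≤ e b := by rw [Fin.le_def]; omega
    have h2 : e b ≤ e d := by rw [Fin.le_def]; omega
    have h3 : w (e c) = w (e b) := le_antisymm (hw h1) (heq ▸ hw h2)
    refine le_trans ?_ (ih h1 h3 hb')
    by_contra! hlt
    exact (h b d (by omega) hlt).ne (h3.symm.trans heq)

theorem Compatible.isTableau_comp {e : α.Cell ≃ Fin n} {w : Fin n → X} (h : Compatible e w)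
    (hw : Monotone w) (he : IsTableau e) : IsTableau (w ∘ e) where
  row c d hcd hlt := by
    have h1 := (he.row c d hcd hlt).le
    refine lt_of_le_of_ne (hw h1) fun heq => ?_
    exact absurd (h.column_le hw h1 heq) (by omega)
  col c d hc hd hcd := hw (he.col c d hc hd hcd)
  triple c d hcd hk hlt := by
    obtain ⟨d', h1, h2, h3⟩ := he.triple c d hcd hk (hw.reflect_lt hlt)
    exact ⟨d', h1, h2, hw h3⟩

theorem Compatible.key_lt_key {e : α.Cell ≃ Fin n} {w : Fin n → X} (h : Compatible e w)
    (hw : Monotone w) (he : IsTableau e) {c d : α.Cell} (hcd : e c < e d) :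
    key (w ∘ e) c < key (w ∘ e) d := by
  rw [key_lt_key_iff]
  rcases (hw hcd.le).lt_or_eq with hlt | heq
  · exact Or.inl hlt
  refine Or.inr ⟨heq, ?_⟩
  rcases (h.column_le hw hcd.le heq).lt_or_eq with h1 | h1
  · exact Or.inl h1
  refine Or.inr ⟨h1.symm, ?_⟩
  have hne : c.1 ≠ d.1 := fun h2 => hcd.ne (congrArg e (cell_ext h2 h1.symm))
  by_cases h0 : (c.2 : ℕ) = 0
  · refine Or.inl ⟨h0, lt_of_le_of_ne (not_lt.1 fun h2 => ?_) hne⟩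
    exact absurd (he.col d c (by omega) h0 h2) (not_le.2 hcd)
  · refine Or.inr ⟨h0, lt_of_le_of_ne (not_lt.1 fun h2 => ?_) hne.symm⟩
    -- Suppose `d` lies above `c`, and let `b` be the left neighbour of `d`. If `b` precedes `c`,
    -- the triple condition puts `d` before `c`. Otherwise `b` and `d` carry equal letters although
    -- the step from `b` to `d` goes right.
    obtain ⟨b, hb1, hb2⟩ : ∃ b : α.Cell, b.1 = d.1 ∧ (b.2 : ℕ) + 1 = d.2 :=
      ⟨⟨d.1, ⟨d.2 - 1, by omega⟩⟩, rfl, by simp only; omega⟩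
    have hbd : e b < e d := he.row b d hb1 (by omega)
    have hcb : e c ≤ e b := by
      by_contra! hlt
      obtain ⟨d', h3, h4, h5⟩ := he.triple c b (hb1 ▸ h2) (by omega) hlt
      obtain rfl : d' = d := cell_ext (h3.trans hb1) (by omega)
      exact absurd h5 (not_le.2 hcd)
    have heq' : w (e b) = w (e d) := le_antisymm (hw hbd.le) (heq ▸ hw hcb)
    have := h.column_le hw hbd.le heq'
    omega

theorem Compatible.lt_iff {e : α.Cell ≃ Fin n} {w : Fin n → X} (h : Compatible e w)
    (hw : Monotone w) (he : IsTableau e) (c d : α.Cell) :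
    e c < e d ↔ key (w ∘ e) c < key (w ∘ e) d := by
  refine ⟨h.key_lt_key hw he, fun hlt => ?_⟩
  by_contra! hle
  rcases hle.lt_or_eq with h1 | h1
  · exact lt_asymm hlt (h.key_lt_key hw he h1)
  · rw [e.injective h1] at hlt
    exact lt_irrefl _ hlt

/-- The only order automorphism of `Fin n` is the identity. -/
theorem numbering_unique {e e' : α.Cell ≃ Fin n} (h : ∀ c d, e c < e d ↔ e' c < e' d) :
    e = e' := by
  have hm : StrictMono (e' ∘ e.symm) := fun p q hpq => by
    simpa [← h] using hpq
  have : ∀ p, e' (e.symm p) = p := fun p => by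
    have := Subsingleton.elim ((e.symm.trans e').toOrderIso hm.monotone (by
      intro p q hpq
      by_contra! hlt
      have := hm hlt
      simp only [Function.comp_apply] at this
      simp at this
      exact absurd this (not_lt.2 hpq))) (OrderIso.refl (Fin n))
    exact DFunLike.congr_fun this p
  ext c
  rw [← this (e c), e.symm_apply_apply]

/-- Numbering the cells in the order of `key T` works: its tie-breaks are those forced by the first
column, the triple condition and compatibility. -/
theorem exists_compatible {T : α.Cell → ℕ+} (hT : IsTableau T) {w : Fin n → ℕ+}
    (hw : Monotone w) (hwt : ∑ c, Finsupp.single (T c) 1 = content w) :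
    ∃ e : α.Cell ≃ Fin n, IsTableau e ∧ Compatible e w ∧ w ∘ e = T := by
  obtain ⟨e, he⟩ := exists_numbering (key_injective T)
  have hmono : Monotone (T ∘ e.symm) := by
    intro p q hpq
    by_contra! hlt
    have : key T (e.symm q) < key T (e.symm p) := key_lt_key_iff.2 (Or.inl hlt)
    rw [← he] at this
    simp only [Equiv.apply_symm_apply] at this
    exact absurd this (not_lt.2 hpq)
  have hcont : content (T ∘ e.symm) = content w := by
    rw [← hwt, content, ← e.sum_comp]
    simp
  have hTw : w ∘ e = T := by
    rw [← content_injOn hmono hw hcont]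
    ext c
    simp
  have hTc : ∀ c, T c = w (e c) := fun c => (congrFun hTw c).symm
  refine ⟨e, ⟨?_, ?_, ?_⟩, ?_, hTw⟩
  · intro c d hcd hlt
    exact (he c d).2 (key_lt_key_iff.2 (Or.inl (hT.row c d hcd hlt)))
  · intro c d hc hd hcd
    refine ((he c d).2 (key_lt_key_iff.2 ?_)).le
    exact (hT.col c d hc hd hcd).lt_or_eq.imp_right fun h =>
      ⟨h, Or.inr ⟨hc.trans hd.symm, Or.inl ⟨hc, hcd⟩⟩⟩
  · intro c d hcd hk hlt
    -- Equal entries are excluded: `d` is one column to the left of `c`, so it would be numbered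
    -- later.
    have h1 : T d < T c := by
      rcases key_lt_key_iff.1 ((he d c).1 hlt) with h | ⟨-, h | ⟨h, -⟩⟩
      · exact h
      · omega
      · omega
    obtain ⟨d', h2, h3, h4⟩ := hT.triple c d hcd hk h1
    refine ⟨d', h2, h3, ((he d' c).2 (key_lt_key_iff.2 ?_)).le⟩
    -- On a tie, `d'` comes first because it lies above `c` in a column other than the first.
    exact h4.lt_or_eq.imp_right fun h => ⟨h, Or.inr ⟨h3, Or.inr ⟨by omega, h2 ▸ hcd⟩⟩⟩
  · intro c d hcd hlt
    have hle : e c ≤ e d := by rw [Fin.le_def]; omega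
    refine lt_of_le_of_ne (hw hle) fun heq => ?_
    have : e d < e c := (he d c).2 (key_lt_key_iff.2 (Or.inr ⟨by rw [hTc, hTc, heq], Or.inl hlt⟩))
    exact absurd this (not_lt.2 hle)

/-- Both sides count compatible standard numberings `e`, through `w ∘ e` and `standardFilling e`.
The first map is injective because `key (w ∘ e)` recovers the order of `e`. -/
theorem card_isSSYRT_weight_eq {w : Fin n → ℕ+} (hw : Monotone w) :
    Nat.card {t : {T : α.Filling // IsSSYRT T} // weight t.1 = content w} =
      Nat.card {U : α.Filling // IsSYRT U ∧ revDescentSet U ⊆ ascents w} := by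
  have hweight : ∀ e : α.Cell ≃ Fin n, weight (w ∘ e : α.Filling) = content w := fun e => by
    rw [weight, content, ← e.sum_comp]
    rfl
  trans Nat.card {e : α.Cell ≃ Fin n // IsTableau e ∧ Compatible e w}
  · refine (Nat.card_eq_of_bijective (fun e => ⟨⟨w ∘ e.1, isSSYRT_iff_isTableau.2
      (e.2.2.isTableau_comp hw e.2.1)⟩, hweight e.1⟩) ⟨?_, ?_⟩).symm
    · rintro ⟨e, he, hc⟩ ⟨e', he', hc'⟩ h
      have h' : w ∘ e = w ∘ e' := congrArg (fun t => t.1.1) h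
      refine Subtype.ext (numbering_unique fun c d => ?_)
      rw [hc.lt_iff hw he, hc'.lt_iff hw he', h']
    · rintro ⟨⟨T, hT⟩, hwt⟩
      obtain ⟨e, he, hc, rfl⟩ := exists_compatible (isSSYRT_iff_isTableau.1 hT) hw hwt
      exact ⟨⟨e, he, hc⟩, rfl⟩
  · refine Nat.card_eq_of_bijective (fun e => ⟨standardFilling e.1, isSYRT_iff.2 ⟨e.1, e.2.1, rfl⟩,
      (revDescentSet_standardFilling_subset_iff _ _).2 e.2.2⟩) ⟨?_, ?_⟩
    · intro e e' h
      exact Subtype.ext (standardFilling_injective (congrArg Subtype.val h))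
    · rintro ⟨U, hU, hs⟩
      obtain ⟨e, he, rfl⟩ := isSYRT_iff.1 hU
      exact ⟨⟨e, he, (revDescentSet_standardFilling_subset_iff _ _).1 hs⟩, rfl⟩

/-! ### Coefficients of `R α` and conclusion -/

theorem card_isSYRT_subset (α : Composition n) (S : Finset ℕ) :
    Nat.card {U : α.Filling // IsSYRT U ∧ revDescentSet U ⊆ S} =
      ∑ β : Composition n, if partialSums β ⊆ S then d α β else 0 := by
  classical
  have h1 : ∀ U : α.Filling, partialSums (comp n (revDescentSet U)) = revDescentSet U := fun U => by
    rw [partialSums_comp, inter_eq_left]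
    exact revDescentSet_subset_Icc U
  have h2 : ∀ β : Composition n, d α β =
      #{U ∈ (finite_isSYRT α).toFinset | comp n (revDescentSet U) = β} := fun β =>
    Nat.subtype_card _ (by simp)
  rw [Nat.subtype_card {U ∈ (finite_isSYRT α).toFinset | revDescentSet U ⊆ S} (by simp),
    ← sum_filter, card_eq_sum_card_fiberwise (f := fun U => comp n (revDescentSet U))
      (t := {β | partialSums β ⊆ S}) (fun U hU => by simpa [h1] using (mem_filter.1 hU).2)]
  refine sum_congr rfl fun β hβ => ?_
  rw [h2, filter_filter]
  refine congrArg _ (filter_congr fun U _ => and_iff_right_of_imp ?_)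
  rintro rfl
  simpa [h1] using hβ

theorem coeff_R_content (α : Composition n) {w : Fin n → ℕ+} (hw : Monotone w) :
    MvPowerSeries.coeff (content w) (R α) =
      ∑ β : Composition n, if partialSums β ⊆ ascents w then (d α β : ℚ) else 0 := by
  change (Nat.card
    {t : {T : α.Filling // IsSSYRT T} // weight t.1 = content w} : ℚ) = _
  rw [card_isSSYRT_weight_eq hw, card_isSYRT_subset]
  push_cast
  rfl

theorem coeff_R_of_degree_ne (α : Composition n) {m : ℕ+ →₀ ℕ} (hm : m.degree ≠ n) :
    MvPowerSeries.coeff m (R α) = 0 := by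
  have : IsEmpty {t : {T : α.Filling // IsSSYRT T} // weight t.1 = m} :=
    ⟨fun t => hm (by simp [← t.2, weight, map_sum])⟩
  change (Nat.card {t : {T : α.Filling // IsSSYRT T} // weight t.1 = m} : ℚ) = 0
  simp

theorem coeff_sum_F_content (c : Composition n → ℚ) {w : Fin n → ℕ+} (hw : Monotone w) :
    MvPowerSeries.coeff (content w) (∑ β, c β • F β) =
      ∑ β, if partialSums β ⊆ ascents w then c β else 0 := by
  simp [map_sum, coeff_F_content _ hw]

end YoungRowStrict

open YoungRowStrict in
theorem mainTheorem2 (n : ℕ) (α : Composition n) :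
    R α = ∑ β : Composition n, (d α β : ℚ) • F β ∧
    (∀ c : Composition n → ℚ, R α = ∑ β : Composition n, c β • F β →
      ∀ β : Composition n, c β = (d α β : ℚ)) ∧
    IsQuasisymmetric (R α) := by
  refine ⟨?_, fun c hc => eq_of_forall_sum_ite_eq fun γ => ?_, ?_⟩
  · ext m
    by_cases hm : m.degree = n
    · obtain ⟨w, hw, rfl⟩ := exists_monotone_content m hm
      rw [coeff_R_content α hw, coeff_sum_F_content _ hw]
    · simp [coeff_R_of_degree_ne α hm, coeff_F_of_degree_ne _ hm]
  · obtain ⟨w, hw, hγ⟩ := exists_content_ascents_eq γ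
    rw [← hγ, ← coeff_sum_F_content c hw, ← hc, coeff_R_content α hw]
  · exact isQuasisymmetric_of_content
      (fun S => ∑ β : Composition n, if partialSums β ⊆ S then (d α β : ℚ) else 0) (fun _ => coeff_R_of_degree_ne α)
      fun _ => coeff_R_content α
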